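/- Let $m\ge 0$ be an integer and $[m]=\{1<2<\dots<m\}$. \textbf{Non-crossing sets.} Two pairs $\{u<v\}$ and $\{x<y\}$ in $\mathbb Z\cup\{\infty\}$ are \emph{non-crossing} if neither $x<u<y<v$ nor $u<x<v<y$ holds. Let $I=\{i_1<\dots<i_k\}$ and $J=\{j_1<\dots<j_l\}$ be subsets of $[m]$ with $k\le l$. Delete $i_s$ and $j_s$ for every $s\le k$ with $i_s=j_s$, and let $i'_1<\dots<i'_{k'}$ and $j'_1<\dots<j'_{l'}$ be the remaining elements of $I$ and $J$. The sets $I$ and $J$ are \emph{non-crossing} if (1) for all $1\le s\le k'-1$ the pairs $\{i'_s,i'_{s+1}\}$ and $\{j'_s,j'_{s+1}\}$ are non-crossing, and (2) if $1\le k'<l'$, the pairs $\{i'_{k'},\infty\}$ and $\{j'_{k'},j'_{k'+1}\}$ are non-crossing. \textbf{Partial staircases.} Choose a set of lattice points (\emph{sinks}) $(x,y)\in\mathbb Z_{\ge0}^2$ with $x+y=m$. The \emph{partial staircase} $L$ with these sinks has as nodes all points of $\mathbb Z_{\ge0}^2$ lying weakly south and weakly west of some chosen sink. To $I\subseteq[m]$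 associate the lattice path $p(I)$ which starts at $(0,0)$ and has $m$ unit steps, the $i$-th step going north if $i\in I$ and east if $i\notin I$. The path $p(I)$ \emph{fits inside} $L$ if all its nodes are nodes of $L$. \textbf{The complex.} Let $\mathbf m^{(nc)}_L$ be the simplicial complex whose vertices are the sets $I\subseteq[m]$ such that $p(I)$ fits inside $L$, and whose faces are the sets of pairwise non-crossing vertices. \textbf{Corollary.} For every $m$ and every partial staircase $L$, the simplicial complex $\mathbf m^{(nc)}_L$ is shellable: it is pure (all facets have the same number of vertices), and its facets can be ordered as $F_1,\dots,F_n$ so that for all $1\le i<j\le n$ there is an index $l<j$ such that $F_i\cap F_j\subseteq F_l\cap F_j$ and $|F_l\cap F_j|=|F_j|-1$. -/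

import Mathlib

/-! ### Shellable simplicial complexes -/

/-- The facets of an abstract simplicial complex: its faces that are maximal under inclusion. -/
def AbstractSimplicialComplex.facets {V : Type*} (K : AbstractSimplicialComplex V) :
    Set (Finset V) :=
  {F | Maximal (fun G : Finset V => G ∈ K.faces) F}

/-- A complex is pure if all its facets have the same number of vertices. -/
def AbstractSimplicialComplex.IsPure {V : Type*} (K : AbstractSimplicialComplex V) : Prop :=
  ∀ F ∈ K.facets, ∀ G ∈ K.facets, F.card = G.card

/-- A shelling of `K` is a list `F_0, F_1, …` of all the facets of `K`, without repetition, such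
that every `F_j` with `j ≥ 1` meets the union of the earlier facets in a pure subcomplex of
codimension one in `F_j`: each intersection `F_i ∩ F_j` with `i < j` lies in some `F_l ∩ F_j` with
`l < j` that consists of all vertices of `F_j` but one. -/
def AbstractSimplicialComplex.IsShelling {V : Type*} [DecidableEq V]
    (K : AbstractSimplicialComplex V) (F : List (Finset V)) : Prop :=
  F.Nodup ∧ (∀ G : Finset V, G ∈ F ↔ G ∈ K.facets) ∧
    ∀ i j : Fin F.length, i < j →
      ∃ l : Fin F.length, l < j ∧ F[i] ∩ F[j] ⊆ F[l] ∩ F[j] ∧ (F[l] ∩ F[j]).card + 1 = F[j].card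

/-- A complex is shellable if it is pure and has a shelling (with finitely many facets). -/
def AbstractSimplicialComplex.IsShellable {V : Type*} [DecidableEq V]
    (K : AbstractSimplicialComplex V) : Prop :=
  K.IsPure ∧ ∃ F : List (Finset V), K.IsShelling F

/-! ### Compatibility complexes -/

/-- The compatibility complex of a relation `c` on `V`: the vertex set is `V`, and the faces are
the (nonempty) finite sets of pairwise compatible vertices. -/
def compatibilityComplex {V : Type*} (c : V → V → Prop) : AbstractSimplicialComplex V where
  faces := {F | F.Nonempty ∧ (F : Set V).Pairwise c}
  isRelLowerSet_faces := fun _ hF =>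
    ⟨hF.1, fun _ hGF hG => ⟨hG, hF.2.mono (Finset.coe_subset.mpr hGF)⟩⟩
  singleton_mem := fun v => ⟨Finset.singleton_nonempty v, by simp⟩

/-! ### The non-crossing rule for subsets of `[m]`

The totally ordered set `[m] = {1 < ⋯ < m}` is represented by `Fin m`. -/

/-- The pairs `u < v` and `x < y` cross. -/
def PairsCross {α : Type*} [LT α] (u v x y : α) : Prop :=
  (x < u ∧ u < y ∧ y < v) ∨ (u < x ∧ x < v ∧ v < y)

/-- Remove from two sequences all entries at positions where the two sequences agree. -/
def removeCommon {α : Type*} [DecidableEq α] : List α → List α → List α × List α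
  | a :: as, b :: bs =>
    if a = b then removeCommon as bs
    else (a :: (removeCommon as bs).1, b :: (removeCommon as bs).2)
  | [], bs => ([], bs)
  | as, [] => (as, [])

/-- The two conditions of the non-crossing rule on the sequences `i'_1 < ⋯ < i'_{k'}` and
`j'_1 < ⋯ < j'_{l'}` that are left when the common part is removed; here `k' ≤ l'`, and the symbol
`∞` is `⊤ : WithTop α`. -/
def NonCrossingReduced {α : Type*} [LT α] (a b : List α) : Prop :=
  (∀ (s : ℕ) (ha : s + 1 < a.length) (hb : s + 1 < b.length),
    ¬ PairsCross a[s] a[s + 1] b[s] b[s + 1]) ∧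
  (∀ (s : ℕ) (ha : s + 1 = a.length) (hb : s + 1 < b.length),
    ¬ PairsCross (a[s] : WithTop α) ⊤ (b[s] : WithTop α) (b[s + 1] : WithTop α))

/-- The non-crossing rule for the increasing sequences of two sets, the shorter one first. -/
def NonCrossingSeq {α : Type*} [LT α] [DecidableEq α] (a b : List α) : Prop :=
  NonCrossingReduced (removeCommon a b).1 (removeCommon a b).2

/-- The subsets `I` and `J` of `[m]` are non-crossing. (The smaller set comes first in the rule; for
`#I = #J` the rule is symmetric.) -/
def NonCrossing {m : ℕ} (I J : Finset (Fin m)) : Prop :=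
  if I.card ≤ J.card then NonCrossingSeq (I.sort (· ≤ ·)) (J.sort (· ≤ ·))
  else NonCrossingSeq (J.sort (· ≤ ·)) (I.sort (· ≤ ·))

/-! ### Lattice paths and partial staircases -/

/-- The node `(x, y)` that the path `p(I)` reaches after `t` steps. The path starts at the source
`(0, 0)`; its steps are numbered by `Fin m`, and it goes north at the steps in `I` and east at the
others. -/
def pathNode {m : ℕ} (I : Finset (Fin m)) (t : ℕ) : ℕ × ℕ :=
  ((Finset.univ.filter fun i : Fin m => i.val < t ∧ i ∉ I).card,
    (Finset.univ.filter fun i : Fin m => i.val < t ∧ i ∈ I).card)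

/-- A partial staircase inside the staircase `L_m`. The sinks of `L_m` are the nodes `(x, y)` with
`x + y = m`, and a partial staircase is given by a selection of them. -/
structure PartialStaircase (m : ℕ) where
  sinks : Finset (ℕ × ℕ)
  sum_eq : ∀ s ∈ sinks, s.1 + s.2 = m

/-- The nodes of a partial staircase: all nodes weakly to the south and west of a chosen sink. -/
def PartialStaircase.nodes {m : ℕ} (L : PartialStaircase m) : Set (ℕ × ℕ) :=
  {v | ∃ s ∈ L.sinks, v.1 ≤ s.1 ∧ v.2 ≤ s.2}

/-- The path `p(I)` fits inside `L`: all its nodes are nodes of `L`. -/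
def PartialStaircase.Fits {m : ℕ} (L : PartialStaircase m) (I : Finset (Fin m)) : Prop :=
  ∀ t ≤ m, pathNode I t ∈ L.nodes

/-- The non-crossing complex of `L`: its vertices are the subsets `I` of `[m]` whose path `p(I)`
fits inside `L`, and its faces are the sets of pairwise non-crossing vertices. -/
def nonCrossingComplex {m : ℕ} (L : PartialStaircase m) :
    AbstractSimplicialComplex {I : Finset (Fin m) // L.Fits I} :=
  compatibilityComplex fun I J => NonCrossing I.val J.val

/-!
Read a subset of `[m]` as the lattice path with `m` steps that goes north at its elements. Two sets
cross exactly if their paths have a common node, or a maximal common segment, such that the path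
that arrives there from the west leaves to the north, while the one that arrives from the south
leaves to the east (`nonCrossing_iff_coherent`). In other words, if the paths that end at a given
node are ordered by the last step in which they differ, east before north, then paths which do not
cross and separate at a node leave it in their order of arrival, east before north. A path fits
inside a partial staircase exactly if it ends at a sink (`PartialStaircase.fits_iff`), so only the
set `K` of the heights of the sinks matters.

This makes the maximal non-crossing families recursive in `m`. Forgetting the last step of all paths
turns such a family into a maximal family `G` of paths of length `m - 1`. Conversely, at each node
where both continuations are allowed, one path `S k` of `G` ending there is chosen, the paths up to
`S k` are continued east, and those from `S k` on are continued north (`extend`,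
`isMaxClique_extend`, `IsMaxClique.exists_eq_extend`). Only the splitting paths `S k` are continued
twice, and every admissible endpoint is reached, so the cardinality of the family is determined by
`m` and `K` (`IsMaxClique.card_eq_card`).

The facets are ranked lexicographically by the rank of `G` and the number of paths that end with an
east step (`exists_shelling_rank`). Let `F` and `F'` be distinct facets such that the rank of `F` is
at most the rank of `F'`. If they extend the same `G`, some splitting path of `F'` is larger than
that of `F`; lowering it to its predecessor exchanges one path of `F'` that is not in `F`. If they
extend `G` and `G'` with `G ≠ G'`, by induction a path `R` of `G'` outside `G` can be exchanged so
that the rank of `G'` drops to that of a family `H`. If `R` is not a splitting path of `F'`, it has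
a unique continuation, and the extension of `H` with the same splitting paths as `F'` contains the
rest of `F'`. If `R` is a splitting path, it can be lowered, provided that it is not the smallest
path to its endpoint; hence this condition is carried along in the induction.
-/

/-! ### Words and coherence -/

/-- Coherence of two words of the same length over `{false = east, true = north}`, written with the
*last* step first. Words of equal length with equally many `true`s end at the same node, and the
lexicographic order compares them at the last step in which they differ. Two paths that separate
at a common node are required to leave it in the order in which they have arrived there. -/
def Coherent : List Bool → List Bool → Prop
  | a :: P, b :: Q => Coherent P Q ∧
      (P.count true = Q.count true → (a < b → P ≤ Q) ∧ (b < a → Q ≤ P))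
  | _, _ => True

/-- The words of length `m` whose number of north steps is allowed by `K`. -/
def IsRoute (m : ℕ) (K : ℕ → Prop) (w : List Bool) : Prop :=
  w.length = m ∧ K (w.count true)

/-- A finite set of pairwise coherent routes. -/
def IsClique (m : ℕ) (K : ℕ → Prop) (F : Finset (List Bool)) : Prop :=
  (∀ w ∈ F, IsRoute m K w) ∧ ∀ v ∈ F, ∀ w ∈ F, Coherent v w

/-- A clique of routes that is maximal under inclusion. -/
def IsMaxClique (m : ℕ) (K : ℕ → Prop) (F : Finset (List Bool)) : Prop :=
  Maximal (IsClique m K) F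

/-- The heights at which a route may be one step before its end, when `K` lists the heights of
the admissible endpoints. -/
def Before (K : ℕ → Prop) (k : ℕ) : Prop := K k ∨ K (k + 1)

theorem finite_isRoute (m : ℕ) (K : ℕ → Prop) : {w | IsRoute m K w}.Finite :=
  (List.finite_length_eq Bool m).subset fun _ hw => hw.1

theorem finite_isClique (m : ℕ) (K : ℕ → Prop) : {F | IsClique m K F}.Finite :=
  (Set.Finite.finite_subsets (finite_isRoute m K)).preimage
    (Finset.coe_injective.injOn) |>.subset fun _ hF _ hw => hF.1 _ hw

theorem IsClique.exists_isMaxClique {m : ℕ} {K : ℕ → Prop} {F : Finset (List Bool)}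
    (hF : IsClique m K F) : ∃ G, F ⊆ G ∧ IsMaxClique m K G :=
  (finite_isClique m K).exists_le_maximal (a := F) hF

theorem IsMaxClique.eq_of_subset {m : ℕ} {K : ℕ → Prop} {F G : Finset (List Bool)}
    (hF : IsMaxClique m K F) (hG : IsClique m K G) (h : F ⊆ G) : F = G :=
  h.antisymm (hF.2 hG h)

theorem IsClique.subset_singleton_nil {K : ℕ → Prop} {F : Finset (List Bool)}
    (hF : IsClique 0 K F) : F ⊆ {[]} := fun w hw => by
  simpa using List.length_eq_zero_iff.1 (hF.1 w hw).1

theorem IsMaxClique.eq_of_zero {K : ℕ → Prop} {F F' : Finset (List Bool)}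
    (hF : IsMaxClique 0 K F) (hF' : IsMaxClique 0 K F') : F = F' := by
  rcases Finset.subset_singleton_iff.1 hF.1.subset_singleton_nil with rfl | rfl
  · exact hF.eq_of_subset hF'.1 (Finset.empty_subset _)
  · exact (hF'.eq_of_subset hF.1 hF'.1.subset_singleton_nil).symm

/-! ### Extending cliques by one step -/

open Classical in
/-- The extension of a set `G` of words by one step. At each height `k` where both continuations
are allowed, the word `S k` splits the words of `G` ending there: the words up to `S k` are
continued east and those from `S k` on are continued north. -/
noncomputable def extend (K : ℕ → Prop) (G : Finset (List Bool)) (S : ℕ → List Bool) :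
    Finset (List Bool) :=
  (G.filter fun P => K (P.count true) ∧ (K (P.count true + 1) → P ≤ S (P.count true))).image
      (List.cons false) ∪
    (G.filter fun P => K (P.count true + 1) ∧ (K (P.count true) → S (P.count true) ≤ P)).image
      (List.cons true)

section Extend

variable {m : ℕ} {K : ℕ → Prop} {G : Finset (List Bool)} {S : ℕ → List Bool}

@[simp] theorem nil_notMem_extend : [] ∉ extend K G S := by simp [extend]

theorem false_cons_mem_extend {P : List Bool} : false :: P ∈ extend K G S ↔
    P ∈ G ∧ K (P.count true) ∧ (K (P.count true + 1) → P ≤ S (P.count true)) := by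
  simp [extend]

theorem true_cons_mem_extend {P : List Bool} : true :: P ∈ extend K G S ↔
    P ∈ G ∧ K (P.count true + 1) ∧ (K (P.count true) → S (P.count true) ≤ P) := by
  simp [extend]

theorem mem_of_cons_mem_extend {a : Bool} {P : List Bool} (h : a :: P ∈ extend K G S) :
    P ∈ G := by
  cases a
  · exact (false_cons_mem_extend.1 h).1
  · exact (true_cons_mem_extend.1 h).1

theorem isClique_extend (hG : IsClique m (Before K) G) : IsClique (m + 1) K (extend K G S) := by
  constructor
  · rintro (_ | ⟨_ | _, P⟩) h
    · simp at h
    · have h' := false_cons_mem_extend.1 h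
      exact ⟨by simp [(hG.1 P h'.1).1], by simpa using h'.2.1⟩
    · have h' := true_cons_mem_extend.1 h
      exact ⟨by simp [(hG.1 P h'.1).1], by simpa using h'.2.1⟩
  · rintro (_ | ⟨a, P⟩) hP (_ | ⟨b, Q⟩) hQ
    · simp at hP
    · simp at hP
    · simp at hQ
    refine ⟨hG.2 _ (mem_of_cons_mem_extend hP) _ (mem_of_cons_mem_extend hQ), fun e => ?_⟩
    cases a <;> cases b
    · simp
    · rw [false_cons_mem_extend] at hP
      rw [true_cons_mem_extend, ← e] at hQ
      exact ⟨fun _ => (hP.2.2 hQ.2.1).trans (hQ.2.2 hP.2.1), by simp⟩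
    · rw [true_cons_mem_extend, e] at hP
      rw [false_cons_mem_extend] at hQ
      exact ⟨by simp, fun _ => (hQ.2.2 hP.2.1).trans (hP.2.2 hQ.2.1)⟩
    · simp

theorem isClique_image_tail {C : Finset (List Bool)} (hC : IsClique (m + 1) K C) :
    IsClique m (Before K) (C.image List.tail) := by
  constructor
  · intro w hw
    obtain ⟨(_ | ⟨a, P⟩), hv, rfl⟩ := Finset.mem_image.1 hw
    · exact absurd (hC.1 _ hv).1 (by simp)
    · obtain ⟨h1, h2⟩ := hC.1 _ hv
      refine ⟨by simpa using h1, ?_⟩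
      cases a
      · exact Or.inl (by simpa using h2)
      · exact Or.inr (by simpa using h2)
  · intro v hv w hw
    obtain ⟨(_ | ⟨a, P⟩), hv', rfl⟩ := Finset.mem_image.1 hv
    · exact absurd (hC.1 _ hv').1 (by simp)
    obtain ⟨(_ | ⟨b, Q⟩), hw', rfl⟩ := Finset.mem_image.1 hw
    · exact absurd (hC.1 _ hw').1 (by simp)
    exact (hC.2 _ hv' _ hw').1

/-- `S` chooses, at each height where both continuations are allowed, an element of `G` ending
there. -/
def IsSplitting (m : ℕ) (K : ℕ → Prop) (G : Finset (List Bool)) (S : ℕ → List Bool) : Prop :=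
  ∀ k ≤ m, K k → K (k + 1) → S k ∈ G ∧ (S k).count true = k

theorem IsClique.count_le (hG : IsClique m K G) {P : List Bool} (hP : P ∈ G) :
    P.count true ≤ m :=
  (hG.1 P hP).1 ▸ List.count_le_length

theorem image_tail_extend (hG : IsClique m (Before K) G) :
    (extend K G S).image List.tail = G := by
  ext P
  constructor
  · intro h
    obtain ⟨(_ | ⟨a, Q⟩), hv, rfl⟩ := Finset.mem_image.1 h
    · simp at hv
    · exact mem_of_cons_mem_extend hv
  · intro h
    by_cases h1 : false :: P ∈ extend K G S
    · exact Finset.mem_image_of_mem List.tail h1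
    by_cases h2 : true :: P ∈ extend K G S
    · exact Finset.mem_image_of_mem List.tail h2
    exfalso
    rw [false_cons_mem_extend] at h1
    rw [true_cons_mem_extend] at h2
    have h3 := le_total P (S (P.count true))
    have h4 : Before K (P.count true) := (hG.1 P h).2
    unfold Before at h4
    tauto

/-- A word with both continuations is the splitting word of its height. -/
theorem eq_of_cons_mem_extend {P : List Bool} (h1 : false :: P ∈ extend K G S)
    (h2 : true :: P ∈ extend K G S) :
    K (P.count true) ∧ K (P.count true + 1) ∧ S (P.count true) = P := by
  rw [false_cons_mem_extend] at h1
  rw [true_cons_mem_extend] at h2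
  exact ⟨h1.2.1, h2.2.1, le_antisymm (h2.2.2 h1.2.1) (h1.2.2 h2.2.1)⟩

theorem IsSplitting.false_cons_mem (hS : IsSplitting m K G S) {k : ℕ} (hk : k ≤ m) (h0 : K k)
    (h1 : K (k + 1)) : false :: S k ∈ extend K G S := by
  obtain ⟨h2, h3⟩ := hS k hk h0 h1
  rw [false_cons_mem_extend, h3]
  exact ⟨h2, h0, fun _ => le_rfl⟩

theorem IsSplitting.true_cons_mem (hS : IsSplitting m K G S) {k : ℕ} (hk : k ≤ m) (h0 : K k)
    (h1 : K (k + 1)) : true :: S k ∈ extend K G S := by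
  obtain ⟨h2, h3⟩ := hS k hk h0 h1
  rw [true_cons_mem_extend, h3]
  exact ⟨h2, h1, fun _ => le_rfl⟩

theorem isMaxClique_extend (hG : IsMaxClique m (Before K) G) (hS : IsSplitting m K G S) :
    IsMaxClique (m + 1) K (extend K G S) := by
  refine ⟨isClique_extend hG.1, fun C hC hle => ?_⟩
  have hle' : extend K G S ⊆ C := hle
  have key : G = C.image List.tail := by
    refine hG.eq_of_subset (isClique_image_tail hC) ?_
    rw [← image_tail_extend (S := S) hG.1]
    exact Finset.image_subset_image hle'
  rintro (_ | ⟨a, P⟩) hP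
  · exact absurd (hC.1 _ hP).1 (by simp)
  have hPG : P ∈ G := key ▸ Finset.mem_image_of_mem List.tail hP
  have hr := (hC.1 _ hP).2
  have hm := hG.1.count_le hPG
  cases a
  · have h0 : K (P.count true) := by simpa using hr
    refine false_cons_mem_extend.2 ⟨hPG, h0, fun h1 => ?_⟩
    exact ((hC.2 _ hP _ (hle' (hS.true_cons_mem hm h0 h1))).2 (hS _ hm h0 h1).2.symm).1 (by decide)
  · have h1 : K (P.count true + 1) := by simpa using hr
    refine true_cons_mem_extend.2 ⟨hPG, h1, fun h0 => ?_⟩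
    exact ((hC.2 _ hP _ (hle' (hS.false_cons_mem hm h0 h1))).2 (hS _ hm h0 h1).2.symm).2 (by decide)

/-- The splitting word at height `k` is the largest word that is continued east, or, if there is
none, the smallest word ending at height `k`. -/
theorem exists_isSplitting_subset_extend {C : Finset (List Bool)} (hC : IsClique (m + 1) K C)
    (hG : IsClique m (Before K) G) (hCG : C.image List.tail ⊆ G)
    (hne : ∀ k ≤ m, Before K k → ∃ w ∈ G, w.count true = k) :
    ∃ S, IsSplitting m K G S ∧ C ⊆ extend K G S := by
  have key : ∀ k, ∃ s : List Bool, k ≤ m → K k → (s ∈ G ∧ s.count true = k) ∧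
      (∀ P, false :: P ∈ C → P.count true = k → P ≤ s) ∧
      (∀ P, true :: P ∈ C → P.count true = k → s ≤ P) := by
    intro k
    by_cases hk : k ≤ m ∧ K k
    swap
    · exact ⟨[], fun h1 h2 => absurd ⟨h1, h2⟩ hk⟩
    let E := G.filter fun P => P.count true = k ∧ false :: P ∈ C
    by_cases hE : E.Nonempty
    · obtain ⟨s, hs, hmax⟩ := E.exists_max_image id hE
      simp only [E, Finset.mem_filter, id] at hs hmax
      refine ⟨s, fun _ _ => ⟨⟨hs.1, hs.2.1⟩, fun P hP hc => ?_, fun P hP hc => ?_⟩⟩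
      · exact hmax P ⟨hCG (Finset.mem_image_of_mem List.tail hP), hc, hP⟩
      · exact ((hC.2 _ hs.2.2 _ hP).2 (hs.2.1.trans hc.symm)).1 (by decide)
    · obtain ⟨w, hw, hwk⟩ := hne k hk.1 (Or.inl hk.2)
      obtain ⟨s, hs, hmin⟩ := (G.filter fun P => P.count true = k).exists_min_image id
        ⟨w, by simp [hw, hwk]⟩
      simp only [Finset.mem_filter, id] at hs hmin
      refine ⟨s, fun _ _ => ⟨hs, fun P hP hc => ?_, fun P hP hc => ?_⟩⟩
      · exact absurd ⟨P, Finset.mem_filter.2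
          ⟨hCG (Finset.mem_image_of_mem List.tail hP), hc, hP⟩⟩ hE
      · exact hmin P ⟨hCG (Finset.mem_image_of_mem List.tail hP), hc⟩
  choose S hS using key
  refine ⟨S, fun k hk h0 _ => (hS k hk h0).1, ?_⟩
  rintro (_ | ⟨a, P⟩) hP
  · exact absurd (hC.1 _ hP).1 (by simp)
  have hPG : P ∈ G := hCG (Finset.mem_image_of_mem List.tail hP)
  have hr := (hC.1 _ hP).2
  have hm := hG.count_le hPG
  cases a
  · have h0 : K (P.count true) := by simpa using hr
    exact false_cons_mem_extend.2 ⟨hPG, h0, fun _ => (hS _ hm h0).2.1 P hP rfl⟩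
  · have h1 : K (P.count true + 1) := by simpa using hr
    exact true_cons_mem_extend.2 ⟨hPG, h1, fun h0 => (hS _ hm h0).2.2 P hP rfl⟩

end Extend

theorem IsMaxClique.exists_eq_extend_of_forall {m : ℕ} {K : ℕ → Prop} {F : Finset (List Bool)}
    (hF : IsMaxClique (m + 1) K F)
    (hne : ∀ G, IsMaxClique m (Before K) G → ∀ k ≤ m, Before K k → ∃ w ∈ G, w.count true = k) :
    ∃ G S, IsMaxClique m (Before K) G ∧ IsSplitting m K G S ∧ F = extend K G S := by
  obtain ⟨G, hFG, hG⟩ := (isClique_image_tail hF.1).exists_isMaxClique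
  obtain ⟨S, hS, hFS⟩ := exists_isSplitting_subset_extend hF.1 hG.1 hFG (hne G hG)
  exact ⟨G, S, hG, hS, hF.eq_of_subset (isClique_extend hG.1) hFS⟩

/-- A maximal clique has a route to every admissible endpoint. -/
theorem IsMaxClique.exists_mem_count_eq {m : ℕ} {K : ℕ → Prop} {F : Finset (List Bool)}
    (hF : IsMaxClique m K F) {k : ℕ} (hk : k ≤ m) (hK : K k) : ∃ w ∈ F, w.count true = k := by
  induction m generalizing K F k with
  | zero =>
    obtain rfl : k = 0 := by omega
    have hc : IsClique 0 K {[]} :=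
      ⟨by simpa [IsRoute] using hK, by simp [Coherent]⟩
    have : F = {[]} := hF.eq_of_subset hc hF.1.subset_singleton_nil
    exact ⟨[], by simp [this], rfl⟩
  | succ m ih =>
    obtain ⟨G, S, hG, hS, rfl⟩ := hF.exists_eq_extend_of_forall fun G hG k hk hK => ih hG hk hK
    rcases Nat.lt_or_ge m k with h | h
    · obtain rfl : k = m + 1 := by omega
      by_cases h0 : K m
      · exact ⟨_, hS.true_cons_mem le_rfl h0 hK, by simp [(hS m le_rfl h0 hK).2]⟩
      · obtain ⟨P, hP, hc⟩ := ih hG le_rfl (Or.inr hK)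
        refine ⟨true :: P, true_cons_mem_extend.2 ⟨hP, ?_, ?_⟩, by simp [hc]⟩ <;> simp [hc, hK, h0]
    · by_cases h1 : K (k + 1)
      · exact ⟨_, hS.false_cons_mem h hK h1, by simp [(hS k h hK h1).2]⟩
      · obtain ⟨P, hP, hc⟩ := ih hG h (Or.inl hK)
        refine ⟨false :: P, false_cons_mem_extend.2 ⟨hP, ?_, ?_⟩, by simp [hc]⟩ <;>
          simp [hc, hK, h1]

theorem IsMaxClique.exists_eq_extend {m : ℕ} {K : ℕ → Prop} {F : Finset (List Bool)}
    (hF : IsMaxClique (m + 1) K F) :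
    ∃ G S, IsMaxClique m (Before K) G ∧ IsSplitting m K G S ∧ F = extend K G S :=
  hF.exists_eq_extend_of_forall fun _ hG _ hk hK => hG.exists_mem_count_eq hk hK

/-! ### Purity -/

open Classical in
/-- Only the splitting words have two continuations. -/
theorem card_extend {m : ℕ} {K : ℕ → Prop} {G : Finset (List Bool)} {S : ℕ → List Bool}
    (hG : IsClique m (Before K) G) (hS : IsSplitting m K G S) :
    (extend K G S).card =
      G.card + ((Finset.range (m + 1)).filter fun k => K k ∧ K (k + 1)).card := by
  unfold extend
  rw [Finset.card_union_of_disjoint, Finset.card_image_of_injective _ List.cons_injective,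
    Finset.card_image_of_injective _ List.cons_injective, ← Finset.card_union_add_card_inter]
  · congr 1
    · congr 1
      ext P
      have h3 := le_total P (S (P.count true))
      have h4 := fun h : P ∈ G => (hG.1 P h).2
      unfold Before at h4
      simp only [Finset.mem_union, Finset.mem_filter]
      by_cases hP : P ∈ G <;> simp only [hP, true_and, false_and, or_self]
      have h5 := h4 hP
      by_cases h0 : K (P.count true) <;> by_cases h1 : K (P.count true + 1) <;> simp_all
    · refine Finset.card_bij' (fun P _ => P.count true) (fun k _ => S k) ?_ ?_ ?_ ?_
      · intro P hP
        simp only [Finset.mem_inter, Finset.mem_filter] at hP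
        have := hG.count_le hP.1.1
        simp only [Finset.mem_filter, Finset.mem_range]
        exact ⟨by omega, hP.1.2.1, hP.2.2.1⟩
      · intro k hk
        simp only [Finset.mem_filter, Finset.mem_range] at hk
        obtain ⟨h1, h2⟩ := hS k (by omega) hk.2.1 hk.2.2
        simp [h1, h2, hk.2]
      · intro P hP
        simp only [Finset.mem_inter, Finset.mem_filter] at hP
        exact le_antisymm (hP.2.2.2 hP.1.2.1) (hP.1.2.2 hP.2.2.1)
      · intro k hk
        simp only [Finset.mem_filter, Finset.mem_range] at hk
        exact (hS k (by omega) hk.2.1 hk.2.2).2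
  · rw [Finset.disjoint_left]
    intro w h1 h2
    obtain ⟨P, -, rfl⟩ := Finset.mem_image.1 h1
    obtain ⟨Q, -, h⟩ := Finset.mem_image.1 h2
    simp at h

theorem IsMaxClique.card_eq_card {m : ℕ} {K : ℕ → Prop} {F F' : Finset (List Bool)}
    (hF : IsMaxClique m K F) (hF' : IsMaxClique m K F') : F.card = F'.card := by
  induction m generalizing K F F' with
  | zero => rw [hF.eq_of_zero hF']
  | succ m ih =>
    obtain ⟨G, S, hG, hS, rfl⟩ := hF.exists_eq_extend
    obtain ⟨G', S', hG', hS', rfl⟩ := hF'.exists_eq_extend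
    rw [card_extend hG.1 hS, card_extend hG'.1 hS', ih hG hG']

/-! ### The exchange property -/

/-- The number of words in `F` that end with an east step. -/
def eastCount (F : Finset (List Bool)) : ℕ := (F.filter fun w => w.head? = some false).card

/-- Lowering one splitting word to its predecessor exchanges a single route of the extension. -/
theorem exists_lower_splitting {m : ℕ} {K : ℕ → Prop} {G : Finset (List Bool)}
    {S : ℕ → List Bool} (hS : IsSplitting m K G S) {k : ℕ}
    (hk : k ≤ m) (h0 : K k) (h1 : K (k + 1)) {Q : List Bool} (hQ : Q ∈ G)
    (hQk : Q.count true = k) (hlt : Q < S k) :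
    ∃ S', IsSplitting m K G S' ∧ eastCount (extend K G S') < eastCount (extend K G S) ∧
      (extend K G S).erase (false :: S k) ⊆ extend K G S' ∧
      ∃ R ∈ extend K G S, R.count true = (false :: S k).count true ∧ R < false :: S k := by
  obtain ⟨T, hT, hmax⟩ := (G.filter fun P => P.count true = k ∧ P < S k).exists_max_image id
    ⟨Q, by simp [hQ, hQk, hlt]⟩
  simp only [Finset.mem_filter, id] at hT hmax
  obtain ⟨hTG, hTk, hTS⟩ := hT
  obtain ⟨hSG, hSk⟩ := hS k hk h0 h1
  have hsub : ∀ P, false :: P ∈ extend K G (Function.update S k T) →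
      false :: P ∈ (extend K G S).erase (false :: S k) := by
    intro P hP
    rw [false_cons_mem_extend] at hP
    rw [Finset.mem_erase, false_cons_mem_extend]
    by_cases hc : P.count true = k
    · rw [hc, Function.update_self] at hP
      have hPT : P ≤ T := hP.2.2 h1
      refine ⟨fun h => ?_, hP.1, by rwa [hc], fun _ => by rw [hc]; exact hPT.trans hTS.le⟩
      rw [(List.cons_injective h : P = S k)] at hPT
      exact absurd hPT (not_le.2 hTS)
    · rw [Function.update_of_ne hc] at hP
      refine ⟨fun h => hc ?_, hP⟩
      rw [(List.cons_injective h : P = S k), hSk]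
  refine ⟨Function.update S k T, fun j hj j0 j1 => ?_, ?_, ?_, false :: T, ?_, ?_, ?_⟩
  · by_cases hc : j = k
    · subst hc
      simp [hTG, hTk]
    · rw [Function.update_of_ne hc]
      exact hS j hj j0 j1
  · refine Finset.card_lt_card (Finset.ssubset_iff_subset_ne.2 ⟨?_, fun he => ?_⟩)
    · rintro (_ | ⟨_ | _, P⟩) hP
      · simp at hP
      · have := hsub P (Finset.mem_filter.1 hP).1
        exact Finset.mem_filter.2 ⟨(Finset.mem_erase.1 this).2, rfl⟩
      · simp at hP
    · have h2 : false :: S k ∈ (extend K G S).filter fun w => w.head? = some false := by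
        simp [hS.false_cons_mem hk h0 h1]
      rw [← he] at h2
      have := hsub _ (Finset.mem_filter.1 h2).1
      simp at this
  · rintro (_ | ⟨_ | _, P⟩) hP
    · simp at hP
    · rw [Finset.mem_erase, false_cons_mem_extend] at hP
      rw [false_cons_mem_extend]
      refine ⟨hP.2.1, hP.2.2.1, fun h => ?_⟩
      have h2 := hP.2.2.2 h
      by_cases hc : P.count true = k
      · rw [hc, Function.update_self]
        rw [hc] at h2
        exact hmax P ⟨hP.2.1, hc, lt_of_le_of_ne h2 fun h => hP.1 (by rw [h])⟩
      · rwa [Function.update_of_ne hc]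
    · rw [Finset.mem_erase, true_cons_mem_extend] at hP
      rw [true_cons_mem_extend]
      refine ⟨hP.2.1, hP.2.2.1, fun h => ?_⟩
      have h2 := hP.2.2.2 h
      by_cases hc : P.count true = k
      · rw [hc, Function.update_self]
        rw [hc] at h2
        exact hTS.le.trans h2
      · rwa [Function.update_of_ne hc]
  · rw [false_cons_mem_extend, hTk]
    exact ⟨hTG, h0, fun _ => hTS.le⟩
  · simp [hTk, hSk]
  · exact List.cons_lt_cons_iff.2 (Or.inr ⟨rfl, hTS⟩)

/-- The words ending east determine the splitting, so two different splittings of `G` can be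
compared at some height. -/
theorem exists_splitting_lt {m : ℕ} {K : ℕ → Prop} {G : Finset (List Bool)}
    {S S' : ℕ → List Bool} (hG : IsMaxClique m (Before K) G) (hS : IsSplitting m K G S)
    (hne : extend K G S ≠ extend K G S')
    (hle : eastCount (extend K G S) ≤ eastCount (extend K G S')) :
    ∃ k ≤ m, K k ∧ K (k + 1) ∧ S k < S' k := by
  by_contra! hcon
  have hsub : (extend K G S').filter (fun w => w.head? = some false) ⊆
      (extend K G S).filter fun w => w.head? = some false := by
    rintro (_ | ⟨_ | _, P⟩) hP
    · simp at hP
    · have h := false_cons_mem_extend.1 (Finset.mem_filter.1 hP).1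
      refine Finset.mem_filter.2 ⟨false_cons_mem_extend.2 ⟨h.1, h.2.1, fun h1 => ?_⟩, rfl⟩
      exact (h.2.2 h1).trans (hcon _ (hG.1.count_le h.1) h.2.1 h1)
    · simp at hP
  have heq := Finset.eq_of_subset_of_card_le hsub hle
  have hSS : ∀ k ≤ m, K k → K (k + 1) → S k ≤ S' k := by
    intro k hk h0 h1
    have h2 : false :: S k ∈ (extend K G S).filter fun w => w.head? = some false := by
      simp [hS.false_cons_mem hk h0 h1]
    rw [← heq] at h2
    have h3 := (false_cons_mem_extend.1 (Finset.mem_filter.1 h2).1).2.2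
    rw [(hS k hk h0 h1).2] at h3
    exact h3 h1
  refine hne ((isMaxClique_extend hG hS).eq_of_subset (isClique_extend hG.1) ?_)
  rintro (_ | ⟨_ | _, P⟩) hP
  · simp at hP
  · have h := false_cons_mem_extend.1 hP
    exact false_cons_mem_extend.2 ⟨h.1, h.2.1, fun h1 =>
      (h.2.2 h1).trans (hSS _ (hG.1.count_le h.1) h.2.1 h1)⟩
  · have h := true_cons_mem_extend.1 hP
    exact true_cons_mem_extend.2 ⟨h.1, h.2.1, fun h0 =>
      (hcon _ (hG.1.count_le h.1) h0 h.2.1).trans (h.2.2 h0)⟩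

/-- Maximal cliques admit a rank function along which they form a shelling: if `F` does not come
after `F'`, then some route `R` of `F'` outside `F` can be exchanged so that the rank drops. The
last clause, that `R` is not the smallest route of `F'` to its endpoint, is not part of the
shelling property but makes the induction on the length work: it guarantees that a splitting
word `R` can be lowered. -/
theorem exists_shelling_rank (m : ℕ) (K : ℕ → Prop) :
    ∃ φ : Finset (List Bool) → ℕ, ∀ F F', IsMaxClique m K F → IsMaxClique m K F' → F ≠ F' →
      φ F ≤ φ F' → ∃ H, IsMaxClique m K H ∧ φ H < φ F' ∧ ∃ R ∈ F', R ∉ F ∧ F'.erase R ⊆ H ∧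
        ∃ Q ∈ F', Q.count true = R.count true ∧ Q < R := by
  induction m generalizing K with
  | zero =>
    exact ⟨fun _ => 0, fun F F' hF hF' hne _ => absurd (hF.eq_of_zero hF') hne⟩
  | succ m ih =>
    obtain ⟨φ, hφ⟩ := ih (Before K)
    -- `N` bounds `eastCount`, so the new rank is the lexicographic combination of the two.
    let N := (finite_isRoute (m + 1) K).toFinset.card + 1
    have hN : ∀ F, IsMaxClique (m + 1) K F → eastCount F < N := fun F hF =>
      Nat.lt_succ_of_le (Finset.card_le_card fun w hw => by
        simpa using hF.1.1 w (Finset.mem_filter.1 hw).1)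
    refine ⟨fun F => φ (F.image List.tail) * N + eastCount F, fun F F' hF hF' hne hle => ?_⟩
    obtain ⟨G, S, hG, hS, rfl⟩ := hF.exists_eq_extend
    obtain ⟨G', S', hG', hS', rfl⟩ := hF'.exists_eq_extend
    simp only [image_tail_extend hG.1, image_tail_extend hG'.1] at hle ⊢
    by_cases hGG : G = G'
    · subst hGG
      obtain ⟨k, hk, h0, h1, hlt⟩ := exists_splitting_lt hG hS hne (by omega)
      obtain ⟨hkG, hkk⟩ := hS k hk h0 h1
      obtain ⟨T, hT, hcard, hsub, hQ⟩ := exists_lower_splitting hS' hk h0 h1 hkG hkk hlt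
      refine ⟨_, isMaxClique_extend hG hT, ?_, _, hS'.false_cons_mem hk h0 h1, ?_, hsub, hQ⟩
      · simp only [image_tail_extend hG.1]
        omega
      · rw [false_cons_mem_extend, (hS' k hk h0 h1).2]
        exact fun h => absurd (h.2.2 h1) (not_le.2 hlt)
    · have hle' : φ G ≤ φ G' := by
        by_contra! h
        have h2 := hN _ hF'
        have h3 : (φ G' + 1) * N ≤ φ G * N := Nat.mul_le_mul_right N h
        rw [Nat.add_mul] at h3
        omega
      obtain ⟨H, hH, hlt, R, hR, hRG, hsub, Q, hQ, hQR, hQlt⟩ := hφ G G' hG hG' hGG hle'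
      have hRm := hG'.1.count_le hR
      by_cases hsplit : K (R.count true) ∧ K (R.count true + 1) ∧ S' (R.count true) = R
      · obtain ⟨h0, h1, hSR⟩ := hsplit
        obtain ⟨T, hT, hcard, hsub, hQ⟩ := exists_lower_splitting hS' hRm h0 h1 hQ hQR
          (hSR.symm ▸ hQlt)
        refine ⟨_, isMaxClique_extend hG' hT, ?_, _, hS'.false_cons_mem hRm h0 h1, ?_, hsub, hQ⟩
        · simp only [image_tail_extend hG'.1]
          omega
        · rw [hSR]
          exact fun h => hRG (mem_of_cons_mem_extend h)
      · -- No splitting word is lost from `G'` to `H`, so `S'` also splits `H`.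
        have hSH : IsSplitting m K H S' := fun k hk h0 h1 => by
          obtain ⟨h2, h3⟩ := hS' k hk h0 h1
          refine ⟨hsub (Finset.mem_erase.2 ⟨fun h => hsplit ?_, h2⟩), h3⟩
          rw [← h, h3]
          exact ⟨h0, h1, rfl⟩
        have hrank : φ ((extend K H S').image List.tail) * N + eastCount (extend K H S') <
            φ G' * N + eastCount (extend K G' S') := by
          rw [image_tail_extend hH.1]
          have h2 := hN _ (isMaxClique_extend hH hSH)
          have h3 : (φ H + 1) * N ≤ φ G' * N := Nat.mul_le_mul_right N hlt
          rw [Nat.add_mul] at h3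
          omega
        have hext : ∀ a P, a :: P ∈ extend K G' S' → P ≠ R → a :: P ∈ extend K H S' := by
          intro a P hP hPR
          have hPH : P ∈ H := hsub (Finset.mem_erase.2 ⟨hPR, mem_of_cons_mem_extend hP⟩)
          cases a
          · exact false_cons_mem_extend.2 ⟨hPH, (false_cons_mem_extend.1 hP).2⟩
          · exact true_cons_mem_extend.2 ⟨hPH, (true_cons_mem_extend.1 hP).2⟩
        have hone : ∀ a b, a :: R ∈ extend K G' S' → b :: R ∈ extend K G' S' → a = b := by
          rintro (_ | _) (_ | _) ha hb
          · rfl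
          · exact absurd (eq_of_cons_mem_extend ha hb) hsplit
          · exact absurd (eq_of_cons_mem_extend hb ha) hsplit
          · rfl
        have hgoal : ∀ a, a :: R ∈ extend K G' S' → (extend K G' S').erase (a :: R) ⊆
            extend K H S' := by
          rintro a ha (_ | ⟨b, P⟩) hP
          · simp at hP
          · rw [Finset.mem_erase] at hP
            refine hext b P hP.2 ?_
            rintro rfl
            exact hP.1 (by rw [hone b a hP.2 ha])
        have hex : ∃ a, a :: R ∈ extend K G' S' := by
          rw [← image_tail_extend (S := S') hG'.1] at hR
          obtain ⟨(_ | ⟨a, P⟩), hP, rfl⟩ := Finset.mem_image.1 hR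
          · simp at hP
          · exact ⟨a, hP⟩
        obtain ⟨a, ha⟩ := hex
        refine ⟨_, isMaxClique_extend hH hSH, hrank, a :: R, ha,
          fun h => hRG (mem_of_cons_mem_extend h), hgoal a ha, ?_⟩
        cases a
        · -- Everything below a word continued east is continued east.
          have h := false_cons_mem_extend.1 ha
          refine ⟨false :: Q, false_cons_mem_extend.2 ⟨hQ, ?_, ?_⟩, by simp [hQR],
            List.cons_lt_cons_iff.2 (Or.inr ⟨rfl, hQlt⟩)⟩ <;> rw [hQR]
          · exact h.2.1
          · exact fun h1 => hQlt.le.trans (h.2.2 h1)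
        · have h := true_cons_mem_extend.1 ha
          by_cases h0 : K (R.count true)
          · -- `R` is not the splitting word of its height, which is therefore smaller.
            refine ⟨_, hS'.true_cons_mem hRm h0 h.2.1, by simp [(hS' _ hRm h0 h.2.1).2],
              List.cons_lt_cons_iff.2 (Or.inr ⟨rfl, ?_⟩)⟩
            exact lt_of_le_of_ne (h.2.2 h0) fun he => hsplit ⟨h0, h.2.1, he⟩
          · refine ⟨true :: Q, true_cons_mem_extend.2 ⟨hQ, ?_, ?_⟩, by simp [hQR],
              List.cons_lt_cons_iff.2 (Or.inr ⟨rfl, hQlt⟩)⟩ <;> rw [hQR]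
            · exact h.2.1
            · exact fun h2 => absurd h2 h0

/-! ### Crossings in terms of rows -/

/-- The time of the `r`-th north step (counted from `0`) of a word, and `M` if there is none. -/
def row (M : ℕ) : List Bool → ℕ → ℕ
  | [], _ => M
  | false :: w, r => row M w r
  | true :: w, r => if r = w.count true then w.length else row M w r

theorem row_of_lt {M : ℕ} : ∀ {w : List Bool} {r : ℕ}, r < w.count true → row M w r < w.length
  | [], r, h => by simp at h
  | false :: w, r, h => by
    have := row_of_lt (M := M) (w := w) (r := r) (by simpa using h)
    simp only [row, List.length_cons]
    omega
  | true :: w, r, h => by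
    simp only [List.count_cons_self] at h
    simp only [row, List.length_cons]
    split_ifs with hr
    · omega
    · have := row_of_lt (M := M) (w := w) (r := r) (by omega)
      omega

theorem row_of_le {M : ℕ} : ∀ {w : List Bool} {r : ℕ}, w.count true ≤ r → row M w r = M
  | [], r, h => rfl
  | false :: w, r, h => by
    simpa only [row] using row_of_le (M := M) (w := w) (r := r) (by simpa using h)
  | true :: w, r, h => by
    simp only [List.count_cons_self] at h
    simp only [row]
    rw [if_neg (by omega), row_of_le (by omega)]

/-- In two rows `s < t` with equal entries in between, `B` comes first, but in row `s` the entry of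
`A` precedes the entry of `B` in row `t`: the two paths meet at a common node, or have a common
segment, and `B` is to the northwest of `A` before and after it. -/
def RowsCross (A B : ℕ → ℕ) : Prop :=
  ∃ s t, s < t ∧ (∀ r, s < r → r < t → A r = B r) ∧ B s < A s ∧ A s < B t ∧ B t < A t

theorem lt_iff_exists_row_lt {M : ℕ} : ∀ {P Q : List Bool}, P.length = Q.length →
    P.length ≤ M → P.count true = Q.count true →
    (Q < P ↔ ∃ s, row M Q s < row M P s ∧ ∀ r, s < r → row M P r = row M Q r)
  | [], [], _, _, _ => by simp [row]
  | [], _ :: _, h, _, _ => by simp at h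
  | _ :: _, [], h, _, _ => by simp at h
  | a :: P, b :: Q, hl, hM, hc => by
    simp only [List.length_cons, Nat.add_right_cancel_iff] at hl hM
    rw [List.cons_lt_cons_iff]
    have hP := fun r => row_of_lt (M := M) (w := P) (r := r)
    have hP' := fun r => row_of_le (M := M) (w := P) (r := r)
    have hQ := fun r => row_of_lt (M := M) (w := Q) (r := r)
    have hQ' := fun r => row_of_le (M := M) (w := Q) (r := r)
    cases a <;> cases b
    · simpa [row] using lt_iff_exists_row_lt hl (by omega) (by simpa using hc)
    · have hc : P.count true = Q.count true + 1 := by simpa using hc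
      simp only [row]
      refine iff_of_false (by simp) ?_
      rintro ⟨s, h1, h2⟩
      rcases lt_trichotomy s (Q.count true) with h | h | h
      · have h3 := h2 _ h
        rw [if_pos rfl] at h3
        have := hP (Q.count true) (by omega)
        omega
      · rw [if_pos h] at h1
        have := hP s (by omega)
        omega
      · rw [if_neg (by omega), hP' s (by omega), hQ' s (by omega)] at h1
        omega
    · have hc : P.count true + 1 = Q.count true := by simpa using hc
      simp only [row]
      refine iff_of_true (Or.inl (by decide)) ⟨P.count true, ?_, fun r hr => ?_⟩
      · rw [if_pos rfl, hl]
        exact hQ _ (by omega)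
      · rw [if_neg (by omega), hP' r (by omega), hQ' r (by omega)]
    · have hc' : P.count true = Q.count true := by simpa using hc
      simp only [lt_self_iff_false, true_and, false_or, row]
      rw [lt_iff_exists_row_lt (M := M) hl (by omega) hc', hc', hl]
      refine exists_congr fun s => ?_
      by_cases hs : s < Q.count true
      · rw [if_neg hs.ne, if_neg hs.ne]
        refine and_congr_right fun _ => forall₂_congr fun r hr => ?_
        split_ifs with h
        · simp [hP' r (by omega), hQ' r (by omega)]
        · rfl
      · refine iff_of_false (fun h => ?_) (fun h => ?_)
        · have := h.1
          rw [hP' s (by omega), hQ' s (by omega)] at this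
          omega
        · have := h.1
          rw [hP' s (by omega), hQ' s (by omega)] at this
          split_ifs at this <;> omega

/-- A last step creates a crossing exactly if the paths leave a common node east and north, against
their order of arrival. -/
theorem rowsCross_cons {M : ℕ} {P Q : List Bool} (a b : Bool) (hl : P.length = Q.length)
    (hM : P.length < M) : RowsCross (row M (a :: P)) (row M (b :: Q)) ↔
      RowsCross (row M P) (row M Q) ∨
        (a = false ∧ b = true ∧ P.count true = Q.count true ∧ Q < P) := by
  have hP := fun r => row_of_lt (M := M) (w := P) (r := r)
  have hP' := fun r => row_of_le (M := M) (w := P) (r := r)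
  have hQ := fun r => row_of_lt (M := M) (w := Q) (r := r)
  have hQ' := fun r => row_of_le (M := M) (w := Q) (r := r)
  have ha : ∀ r, row M (a :: P) r = row M P r ∨
      (a = true ∧ r = P.count true ∧ row M (a :: P) r = P.length ∧ row M P r = M) := by
    intro r
    cases a
    · exact Or.inl rfl
    · by_cases h : r = P.count true
      · exact Or.inr ⟨rfl, h, by simp [row, h], hP' r h.ge⟩
      · exact Or.inl (by simp [row, h])
  have hb : ∀ r, row M (b :: Q) r = row M Q r ∨
      (b = true ∧ r = Q.count true ∧ row M (b :: Q) r = Q.length ∧ row M Q r = M) := by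
    intro r
    cases b
    · exact Or.inl rfl
    · by_cases h : r = Q.count true
      · exact Or.inr ⟨rfl, h, by simp [row, h], hQ' r h.ge⟩
      · exact Or.inl (by simp [row, h])
  have hPM : ∀ r, row M P r < P.length ∧ r < P.count true ∨
      row M P r = M ∧ P.count true ≤ r := fun r =>
    (lt_or_ge r (P.count true)).imp (fun h => ⟨hP r h, h⟩) fun h => ⟨hP' r h, h⟩
  have hQM : ∀ r, row M Q r < Q.length ∧ r < Q.count true ∨
      row M Q r = M ∧ Q.count true ≤ r := fun r =>
    (lt_or_ge r (Q.count true)).imp (fun h => ⟨hQ r h, h⟩) fun h => ⟨hQ' r h, h⟩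
  constructor
  · rintro ⟨s, t, hst, heq, h1, h2, h3⟩
    have hPs := hPM s
    have hPt := hPM t
    have hQs := hQM s
    have hQt := hQM t
    have has := ha s
    have hat := ha t
    have hbs := hb s
    have hbt := hb t
    rcases hbt with hbt | ⟨hb1, hb2, hb3, hb4⟩
    · left
      have h4 : row M P s = row M (a :: P) s := by omega
      have h5 : row M Q s = row M (b :: Q) s := by omega
      refine ⟨s, t, hst, fun r hr hrt => ?_, by omega, by omega, by omega⟩
      have := heq r hr hrt
      have hPr := hPM r
      have hQr := hQM r
      have har := ha r
      have hbr := hb r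
      omega
    · right
      have h4 : row M P s = row M (a :: P) s := by omega
      have h5 : row M Q s = row M (b :: Q) s := by omega
      have hcount : P.count true = Q.count true := by
        by_contra hne
        have hlt : P.count true < t := by
          rcases has with _ | ⟨_, h⟩ <;> omega
        have := heq (P.count true) (by omega) hlt
        have hPr := hPM (P.count true)
        have hQr := hQM (P.count true)
        have har := ha (P.count true)
        have hbr := hb (P.count true)
        omega
      have hfalse : a = false := by
        cases a
        · rfl
        · have : row M (true :: P) t = P.length := by simp [row, hb2, hcount]
          omega
      refine ⟨hfalse, hb1, hcount, (lt_iff_exists_row_lt hl hM.le hcount).2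
        ⟨s, by omega, fun r hr => ?_⟩⟩
      rcases lt_or_ge r t with h | h
      · have := heq r hr h
        have hPr := hPM r
        have hQr := hQM r
        have har := ha r
        have hbr := hb r
        omega
      · rw [hP' r (by omega), hQ' r (by omega)]
  · rintro (⟨s, t, hst, heq, h1, h2, h3⟩ | ⟨rfl, rfl, hc, hlt⟩)
    · have hPs := hPM s
      have hPt := hPM t
      have hQs := hQM s
      have hQt := hQM t
      have has := ha s
      have hat := ha t
      have hbs := hb s
      have hbt := hb t
      refine ⟨s, t, hst, fun r hr hrt => ?_, by omega, by omega, by omega⟩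
      have := heq r hr hrt
      have hPr := hPM r
      have hQr := hQM r
      have har := ha r
      have hbr := hb r
      omega
    · obtain ⟨s, hs, heq⟩ := (lt_iff_exists_row_lt hl hM.le hc).1 hlt
      have hPs := hPM s
      have hQs := hQM s
      refine ⟨s, Q.count true, by omega, fun r hr hrt => ?_, ?_, ?_, ?_⟩ <;> simp only [row]
      · rw [if_neg (by omega), heq r hr]
      · rwa [if_neg (by omega)]
      · rw [if_true]
        omega
      · rw [if_true, hP' _ hc.le]
        omega

theorem coherent_iff_not_rowsCross {M : ℕ} : ∀ {P Q : List Bool}, P.length = Q.length →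
    P.length ≤ M →
    (Coherent P Q ↔ ¬ (RowsCross (row M P) (row M Q) ∨ RowsCross (row M Q) (row M P)))
  | [], [], _, _ => by simp [RowsCross, Coherent, row]
  | [], _ :: _, h, _ => by simp at h
  | _ :: _, [], h, _ => by simp at h
  | a :: P, b :: Q, hl, hM => by
    simp only [List.length_cons, Nat.add_right_cancel_iff] at hl hM
    rw [rowsCross_cons a b hl hM, rowsCross_cons b a hl.symm (by omega), Coherent,
      coherent_iff_not_rowsCross hl (by omega : P.length ≤ M)]
    have hft : ¬ true < false := by decide
    cases a <;> cases b <;>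
      simp only [← not_lt, lt_self_iff_false, Bool.false_lt_true, hft, reduceCtorEq] <;> grind

/-! ### Crossings after the removal of common entries -/

theorem rowsCross_iff_succ {A B : ℕ → ℕ} (h : A 0 = B 0) :
    RowsCross A B ↔ RowsCross (fun r => A (r + 1)) (fun r => B (r + 1)) := by
  constructor
  · rintro ⟨s, t, hst, heq, h1, h2, h3⟩
    obtain _ | s := s
    · omega
    obtain _ | t := t
    · omega
    exact ⟨s, t, by omega, fun r hr hrt => heq _ (by omega) (by omega), h1, h2, h3⟩
  · rintro ⟨s, t, hst, heq, h1, h2, h3⟩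
    refine ⟨s + 1, t + 1, by omega, fun r hr hrt => ?_, h1, h2, h3⟩
    obtain _ | r := r
    · omega
    exact heq r (by omega) (by omega)

theorem rowsCross_iff_or_succ {A B : ℕ → ℕ} (h : A 1 ≠ B 1) :
    RowsCross A B ↔ (B 0 < A 0 ∧ A 0 < B 1 ∧ B 1 < A 1) ∨
      RowsCross (fun r => A (r + 1)) (fun r => B (r + 1)) := by
  constructor
  · rintro ⟨s, t, hst, heq, h1, h2, h3⟩
    obtain _ | s := s
    · obtain _ | _ | t := t
      · omega
      · exact Or.inl ⟨h1, h2, h3⟩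
      · exact absurd (heq 1 (by omega) (by omega)) h
    obtain _ | t := t
    · omega
    exact Or.inr ⟨s, t, by omega, fun r hr hrt => heq _ (by omega) (by omega), h1, h2, h3⟩
  · rintro (h | ⟨s, t, hst, heq, h1, h2, h3⟩)
    · exact ⟨0, 1, by omega, fun r hr hrt => by omega, h⟩
    · refine ⟨s + 1, t + 1, by omega, fun r hr hrt => ?_, h1, h2, h3⟩
      obtain _ | r := r
      · omega
      exact heq r (by omega) (by omega)

/-- The entries of a list in `Fin m`, with `m` in the role of `∞` beyond its end. -/
def entry {m : ℕ} : List (Fin m) → ℕ → ℕ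
  | [], _ => m
  | a :: _, 0 => a
  | _ :: as, r + 1 => entry as r

theorem entry_le {m : ℕ} : ∀ (as : List (Fin m)) (r : ℕ), entry as r ≤ m
  | [], _ => le_rfl
  | a :: _, 0 => a.2.le
  | _ :: as, r + 1 => entry_le as r

theorem rowsCross_entry_cons_cons {m : ℕ} {x y a : Fin m} {as bs : List (Fin m)} :
    RowsCross (entry (x :: a :: as)) (entry (y :: a :: bs)) ↔
      RowsCross (entry (x :: as)) (entry (y :: bs)) := by
  constructor
  · rintro ⟨s, t, hst, heq, h1, h2, h3⟩
    obtain _ | _ | t := t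
    · omega
    · simp [entry] at h3
    obtain _ | _ | s := s
    · refine ⟨0, t + 1, by omega, fun r hr hrt => ?_, h1, h2, h3⟩
      obtain _ | r := r
      · omega
      exact heq (r + 2) (by omega) (by omega)
    · simp [entry] at h1
    · refine ⟨s + 1, t + 1, by omega, fun r hr hrt => ?_, h1, h2, h3⟩
      obtain _ | r := r
      · omega
      exact heq (r + 2) (by omega) (by omega)
  · rintro ⟨s, t, hst, heq, h1, h2, h3⟩
    obtain _ | t := t
    · omega
    obtain _ | s := s
    · refine ⟨0, t + 2, by omega, fun r hr hrt => ?_, h1, h2, h3⟩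
      obtain _ | _ | r := r
      · omega
      · rfl
      exact heq (r + 1) (by omega) (by omega)
    · refine ⟨s + 2, t + 2, by omega, fun r hr hrt => ?_, h1, h2, h3⟩
      obtain _ | _ | r := r
      · omega
      · rfl
      exact heq (r + 1) (by omega) (by omega)

theorem nonCrossingReduced_cons_cons {m : ℕ} {x y a b : Fin m} {as bs : List (Fin m)} :
    NonCrossingReduced (x :: a :: as) (y :: b :: bs) ↔
      ¬ PairsCross x a y b ∧ NonCrossingReduced (a :: as) (b :: bs) := by
  constructor
  · rintro ⟨h1, h2⟩
    refine ⟨h1 0 (by simp) (by simp), fun s ha hb => ?_, fun s ha hb => ?_⟩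
    · exact h1 (s + 1) (by simpa using ha) (by simpa using hb)
    · exact h2 (s + 1) (by simpa using ha) (by simpa using hb)
  · rintro ⟨h0, h1, h2⟩
    refine ⟨fun s ha hb => ?_, fun s ha hb => ?_⟩
    · obtain _ | s := s
      · exact h0
      · exact h1 s (by simpa using ha) (by simpa using hb)
    · obtain _ | s := s
      · simp at ha
      · exact h2 s (by simpa using ha) (by simpa using hb)

theorem nonCrossingReduced_singleton {m : ℕ} {x y b : Fin m} {bs : List (Fin m)} :
    NonCrossingReduced [x] (y :: b :: bs) ↔
      ¬ PairsCross (x : WithTop (Fin m)) ⊤ (y : WithTop (Fin m)) (b : WithTop (Fin m)) := by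
  constructor
  · exact fun h => h.2 0 (by simp) (by simp)
  · refine fun h => ⟨fun s ha hb => by simp at ha, fun s ha hb => ?_⟩
    obtain _ | s := s
    · exact h
    · simp at ha

/-- Entries removed from both lists do not affect crossings, since `RowsCross` allows any number of
common rows between the two rows it compares. Only the first list can end early, so the value `m`
beyond its end plays the part of `∞` in the second non-crossing condition. -/
theorem nonCrossingReduced_cons_removeCommon {m : ℕ} : ∀ {as bs : List (Fin m)} {x y : Fin m},
    as.length ≤ bs.length →
    (NonCrossingReduced (x :: (removeCommon as bs).1) (y :: (removeCommon as bs).2) ↔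
      ¬ (RowsCross (entry (x :: as)) (entry (y :: bs)) ∨
        RowsCross (entry (y :: bs)) (entry (x :: as))))
  | [], [], x, y, _ => by
    have h : ∀ x y : Fin m, ¬ RowsCross (entry [x]) (entry [y]) := by
      rintro x y ⟨s, _ | t, hst, -, -, -, h3⟩
      · omega
      · simp [entry] at h3
    simp [removeCommon, h, NonCrossingReduced]
  | [], b :: bs, x, y, _ => by
    have h : ∀ t, entry ([] : List (Fin m)) t = m := fun _ => rfl
    have h1 : (entry [x]) 1 ≠ entry (y :: b :: bs) 1 := fun h => by
      have := b.2
      simp only [entry] at h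
      omega
    rw [rowsCross_iff_or_succ h1, rowsCross_iff_or_succ h1.symm]
    have h2 : ¬ RowsCross (entry ([] : List (Fin m))) (entry (b :: bs)) := by
      rintro ⟨s, t, -, -, -, h2, -⟩
      have := entry_le (b :: bs) t
      rw [h s] at h2
      omega
    have h3 : ¬ RowsCross (entry (b :: bs)) (entry ([] : List (Fin m))) := by
      rintro ⟨s, t, -, -, -, -, h3⟩
      have := entry_le (b :: bs) t
      rw [h t] at h3
      omega
    have hb := b.2
    change _ ↔ ¬ ((_ ∨ RowsCross (entry []) (entry (b :: bs))) ∨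
      _ ∨ RowsCross (entry (b :: bs)) (entry []))
    simp only [h2, h3]
    simp only [removeCommon, nonCrossingReduced_singleton, PairsCross, entry,
      WithTop.coe_lt_coe, WithTop.coe_lt_top, not_top_lt, Fin.lt_def]
    grind
  | _ :: _, [], _, _, h => by simp at h
  | a :: as, b :: bs, x, y, h => by
    have hl : as.length ≤ bs.length := by simpa using h
    by_cases hab : a = b
    · subst hab
      rw [rowsCross_entry_cons_cons, rowsCross_entry_cons_cons,
        ← nonCrossingReduced_cons_removeCommon hl]
      simp [removeCommon]
    · have h1 : entry (x :: a :: as) 1 ≠ entry (y :: b :: bs) 1 := fun h =>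
        hab (Fin.ext h)
      have ih := nonCrossingReduced_cons_removeCommon (x := a) (y := b) hl
      rw [rowsCross_iff_or_succ h1, rowsCross_iff_or_succ h1.symm]
      simp only [removeCommon, if_neg hab, nonCrossingReduced_cons_cons, ih, PairsCross, entry,
        Fin.lt_def]
      tauto

theorem nonCrossingSeq_iff {m : ℕ} : ∀ {as bs : List (Fin m)}, as.length ≤ bs.length →
    (NonCrossingSeq as bs ↔
      ¬ (RowsCross (entry as) (entry bs) ∨ RowsCross (entry bs) (entry as)))
  | [], bs, _ => by
    refine iff_of_true ?_ ?_
    · cases bs <;> simp [NonCrossingSeq, removeCommon, NonCrossingReduced]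
    · rintro (⟨s, t, -, -, -, h2, -⟩ | ⟨s, t, -, -, -, -, h3⟩)
      · exact absurd (entry_le bs t) (not_le.2 h2)
      · exact absurd (entry_le bs t) (not_le.2 h3)
  | _ :: _, [], h => by simp at h
  | a :: as, b :: bs, h => by
    have hl : as.length ≤ bs.length := by simpa using h
    by_cases hab : a = b
    · subst hab
      rw [rowsCross_iff_succ (A := entry (a :: as)) (B := entry (a :: bs)) rfl,
        rowsCross_iff_succ (A := entry (a :: bs)) (B := entry (a :: as)) rfl]
      simp only [NonCrossingSeq, removeCommon, if_pos]
      exact nonCrossingSeq_iff hl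
    · rw [← nonCrossingReduced_cons_removeCommon hl]
      simp only [NonCrossingSeq, removeCommon, if_neg hab]

/-! ### The word of a set -/

/-- The word of the first `n` letters of a sequence, the last letter first. -/
def wordOf (p : ℕ → Bool) : ℕ → List Bool
  | 0 => []
  | n + 1 => p n :: wordOf p n

@[simp] theorem length_wordOf (p : ℕ → Bool) (n : ℕ) : (wordOf p n).length = n := by
  induction n with
  | zero => rfl
  | succ n ih => simp [wordOf, ih]

theorem count_wordOf (p : ℕ → Bool) (n : ℕ) :
    (wordOf p n).count true = ((List.range n).filter p).length := by
  induction n with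
  | zero => rfl
  | succ n ih => cases h : p n <;> simp [wordOf, ih, h, List.range_succ]

theorem row_wordOf (M : ℕ) (p : ℕ → Bool) (n r : ℕ) :
    row M (wordOf p n) r = ((List.range n).filter p).getD r M := by
  induction n with
  | zero => simp [wordOf, row]
  | succ n ih =>
    cases h : p n
    · simp [wordOf, row, h, List.range_succ, ih]
    · simp only [wordOf, h, row, count_wordOf, length_wordOf, List.range_succ, List.filter_append,
        List.filter_cons, List.filter_nil, if_true]
      rcases lt_trichotomy r ((List.range n).filter p).length with hr | hr | hr
      · rw [if_neg hr.ne, ih, List.getD_append _ _ _ _ hr]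
      · rw [if_pos hr, List.getD_append_right _ _ _ _ hr.ge, hr]
        simp
      · rw [if_neg hr.ne', ih, List.getD_eq_default _ _ hr.le, List.getD_eq_default]
        simp
        omega

theorem wordOf_inj {p q : ℕ → Bool} {n : ℕ} :
    wordOf p n = wordOf q n ↔ ∀ i < n, p i = q i := by
  induction n with
  | zero => simp [wordOf]
  | succ n ih => rw [wordOf, wordOf, List.cons.injEq, ih, Nat.forall_lt_succ_right, and_comm]

theorem exists_wordOf_eq (w : List Bool) : ∃ p, wordOf p w.length = w := by
  induction w with
  | nil => exact ⟨fun _ => true, rfl⟩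
  | cons a w ih =>
    obtain ⟨p, hp⟩ := ih
    refine ⟨Function.update p w.length a, ?_⟩
    simp only [List.length_cons, wordOf, Function.update_self, List.cons.injEq, true_and]
    nth_rw 3 [← hp]
    exact wordOf_inj.2 fun i hi => Function.update_of_ne hi.ne _ _

/-- The word of the lattice path of a subset of `[m]`. -/
def pathWord {m : ℕ} (I : Finset (Fin m)) : List Bool :=
  wordOf (fun i => decide (i ∈ I.map Fin.valEmbedding)) m

theorem map_sort_eq_filter_range {m : ℕ} (I : Finset (Fin m)) :
    (I.sort (· ≤ ·)).map Fin.val =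
      (List.range m).filter fun i => decide (i ∈ I.map Fin.valEmbedding) := by
  refine List.Perm.eq_of_pairwise (le := (· ≤ ·)) (fun _ _ _ _ => le_antisymm) ?_ ?_ ?_
  · exact List.pairwise_map.2 (I.pairwise_sort (· ≤ ·))
  · exact (List.pairwise_le_range).filter _
  · refine (List.perm_ext_iff_of_nodup ((I.sort_nodup _).map Fin.val_injective)
      (List.nodup_range.filter _)).2 fun i => ?_
    simp only [List.mem_map, Finset.mem_sort, List.mem_filter, List.mem_range, decide_eq_true_eq,
      Finset.mem_map, Fin.valEmbedding_apply]
    exact ⟨fun ⟨a, h1, h2⟩ => ⟨h2 ▸ a.2, a, h1, h2⟩, fun h => h.2⟩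

theorem entry_eq_getD {m : ℕ} : ∀ (as : List (Fin m)) (r : ℕ),
    entry as r = (as.map Fin.val).getD r m
  | [], _ => rfl
  | _ :: _, 0 => rfl
  | _ :: as, r + 1 => by simpa [entry] using entry_eq_getD as r

theorem entry_sort {m : ℕ} (I : Finset (Fin m)) : entry (I.sort (· ≤ ·)) = row m (pathWord I) := by
  ext r
  rw [entry_eq_getD, map_sort_eq_filter_range, pathWord, row_wordOf]

theorem length_pathWord {m : ℕ} (I : Finset (Fin m)) : (pathWord I).length = m :=
  length_wordOf _ _

theorem count_pathWord {m : ℕ} (I : Finset (Fin m)) : (pathWord I).count true = I.card := by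
  rw [pathWord, count_wordOf, ← map_sort_eq_filter_range, List.length_map, Finset.length_sort]

theorem nonCrossing_iff_coherent {m : ℕ} (I J : Finset (Fin m)) :
    NonCrossing I J ↔ Coherent (pathWord I) (pathWord J) := by
  rw [coherent_iff_not_rowsCross (by simp [length_pathWord]) (length_pathWord I).le, ← entry_sort,
    ← entry_sort]
  unfold NonCrossing
  split_ifs with h
  · exact nonCrossingSeq_iff (by simpa using h)
  · rw [nonCrossingSeq_iff (by simpa using (not_le.1 h).le), or_comm]

theorem pathWord_injective {m : ℕ} : Function.Injective (pathWord (m := m)) := by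
  intro I J h
  ext i
  simpa [Fin.val_inj] using wordOf_inj.1 h i i.2

theorem exists_pathWord_eq (w : List Bool) : ∃ I : Finset (Fin w.length), pathWord I = w := by
  obtain ⟨p, hp⟩ := exists_wordOf_eq w
  refine ⟨Finset.univ.filter fun i => p i = true, ?_⟩
  conv_rhs => rw [← hp]
  refine wordOf_inj.2 fun i hi => ?_
  rw [Bool.eq_iff_iff]
  simp only [decide_eq_true_eq, Finset.mem_map, Finset.mem_filter, Finset.mem_univ, true_and,
    Fin.valEmbedding_apply]
  exact ⟨fun ⟨a, h1, h2⟩ => h2 ▸ h1, fun h => ⟨⟨i, hi⟩, h, rfl⟩⟩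

/-- A path fits inside a partial staircase exactly if it ends at a sink. -/
theorem PartialStaircase.fits_iff {m : ℕ} (L : PartialStaircase m) (I : Finset (Fin m)) :
    L.Fits I ↔ ∃ s ∈ L.sinks, s.2 = I.card := by
  have hx : (pathNode I m).1 + I.card = m := by
    have h : (Finset.univ.filter fun i : Fin m => i.val < m ∧ i ∉ I) = Iᶜ := by
      ext i
      simp
    simp only [pathNode, h, Finset.card_compl, Fintype.card_fin]
    have := I.card_le_univ
    simp only [Fintype.card_fin] at this
    omega
  have hy : (pathNode I m).2 = I.card := by
    simp [pathNode]
  have hmono : ∀ t ≤ m, (pathNode I t).1 ≤ (pathNode I m).1 ∧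
      (pathNode I t).2 ≤ (pathNode I m).2 := by
    intro t ht
    unfold pathNode
    constructor <;> dsimp only <;> refine Finset.card_le_card fun i hi => ?_ <;>
      simp only [Finset.mem_filter, Finset.mem_univ, true_and] at hi ⊢ <;>
      exact ⟨hi.1.trans_le ht, hi.2⟩
  constructor
  · intro h
    obtain ⟨s, hs, h1, h2⟩ := h m le_rfl
    have := L.sum_eq s hs
    exact ⟨s, hs, by omega⟩
  · rintro ⟨s, hs, hsI⟩ t ht
    have := L.sum_eq s hs
    refine ⟨s, hs, ?_, ?_⟩
    · refine (hmono t ht).1.trans (by omega : (pathNode I m).1 ≤ s.1)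
    · refine (hmono t ht).2.trans (by omega : (pathNode I m).2 ≤ s.2)

/-! ### The non-crossing complex -/

theorem Coherent.refl : ∀ w, Coherent w w
  | [] => trivial
  | _ :: w => ⟨Coherent.refl w, fun _ => ⟨fun _ => le_rfl, fun _ => le_rfl⟩⟩

/-- The words of the vertices of the non-crossing complex. -/
def PartialStaircase.vertexWord {m : ℕ} (L : PartialStaircase m) :
    {I : Finset (Fin m) // L.Fits I} ↪ List Bool where
  toFun I := pathWord I.val
  inj' _ _ h := Subtype.ext (pathWord_injective h)

/-- The heights of the sinks. -/
def PartialStaircase.IsHeight {m : ℕ} (L : PartialStaircase m) (k : ℕ) : Prop :=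
  ∃ s ∈ L.sinks, s.2 = k

section Complex

variable {m : ℕ} {L : PartialStaircase m}

theorem isRoute_vertexWord (v : {I : Finset (Fin m) // L.Fits I}) :
    IsRoute m L.IsHeight (L.vertexWord v) :=
  ⟨length_pathWord _, (count_pathWord v.val).symm ▸ (L.fits_iff _).1 v.2⟩

theorem IsRoute.exists_vertexWord_eq {w : List Bool} (hw : IsRoute m L.IsHeight w) :
    ∃ v, L.vertexWord v = w := by
  obtain ⟨rfl, h⟩ := hw
  obtain ⟨I, hI⟩ := exists_pathWord_eq w
  refine ⟨⟨I, (L.fits_iff I).2 ?_⟩, hI⟩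
  rwa [← count_pathWord, hI]

theorem IsClique.exists_map_eq {C : Finset (List Bool)} (hC : IsClique m L.IsHeight C) :
    ∃ G : Finset {I : Finset (Fin m) // L.Fits I}, G.map L.vertexWord = C := by
  refine ⟨C.preimage L.vertexWord L.vertexWord.injective.injOn, ?_⟩
  ext w
  simp only [Finset.mem_map, Finset.mem_preimage]
  refine ⟨fun ⟨v, hv, h⟩ => h ▸ hv, fun hw => ?_⟩
  obtain ⟨v, rfl⟩ := (hC.1 w hw).exists_vertexWord_eq
  exact ⟨v, hw, rfl⟩

theorem isClique_map_iff {G : Finset {I : Finset (Fin m) // L.Fits I}} :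
    IsClique m L.IsHeight (G.map L.vertexWord) ↔
      (G : Set {I : Finset (Fin m) // L.Fits I}).Pairwise
        fun I J => NonCrossing I.val J.val := by
  constructor
  · intro h I hI J hJ _
    exact (nonCrossing_iff_coherent _ _).2
      (h.2 _ (Finset.mem_map_of_mem _ hI) _ (Finset.mem_map_of_mem _ hJ))
  · intro h
    constructor
    · intro w hw
      obtain ⟨v, -, rfl⟩ := Finset.mem_map.1 hw
      exact isRoute_vertexWord v
    · intro v hv w hw
      obtain ⟨I, hI, rfl⟩ := Finset.mem_map.1 hv
      obtain ⟨J, hJ, rfl⟩ := Finset.mem_map.1 hw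
      by_cases hIJ : I = J
      · subst hIJ
        exact Coherent.refl _
      · exact (nonCrossing_iff_coherent _ _).1 (h hI hJ hIJ)

theorem mem_facets_iff {G : Finset {I : Finset (Fin m) // L.Fits I}} :
    G ∈ (nonCrossingComplex L).facets ↔
      G.Nonempty ∧ IsMaxClique m L.IsHeight (G.map L.vertexWord) := by
  constructor
  · intro h
    refine ⟨h.1.1, isClique_map_iff.2 h.1.2, fun C hC hGC => ?_⟩
    obtain ⟨D, rfl⟩ := hC.exists_map_eq
    have hGD : G ⊆ D := Finset.map_subset_map.1 hGC
    exact Finset.map_subset_map.2 (h.2 ⟨h.1.1.mono hGD, isClique_map_iff.1 hC⟩ hGD)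
  · rintro ⟨hne, h⟩
    refine ⟨⟨hne, isClique_map_iff.1 h.1⟩, fun D hD hGD => ?_⟩
    exact Finset.map_subset_map.1 (h.2 (isClique_map_iff.2 hD.2) (Finset.map_subset_map.2 hGD))

end Complex

theorem mainTheorem6 (m : ℕ) (L : PartialStaircase m) :
    (nonCrossingComplex L).IsShellable := by
  constructor
  · intro F hF G hG
    simpa using (mem_facets_iff.1 hF).2.card_eq_card (mem_facets_iff.1 hG).2
  obtain ⟨φ, hφ⟩ := exists_shelling_rank m L.IsHeight
  let r (F G : Finset {I : Finset (Fin m) // L.Fits I}) : Prop :=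
    φ (F.map L.vertexWord) ≤ φ (G.map L.vertexWord)
  classical
  have htotal : Std.Total r := ⟨fun F G => le_total _ _⟩
  have htrans : IsTrans _ r := ⟨fun F G H => le_trans⟩
  have hfin : (nonCrossingComplex L).facets.Finite := Set.toFinite _
  let l := hfin.toFinset.toList.insertionSort r
  have hmem : ∀ G, G ∈ l ↔ G ∈ (nonCrossingComplex L).facets := by simp [l]
  have hnodup : l.Nodup := (List.perm_insertionSort r _).nodup_iff.2 (Finset.nodup_toList _)
  have hsort : l.Pairwise r := List.pairwise_insertionSort r _
  refine ⟨l, hnodup, hmem, fun i j hij => ?_⟩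
  have hi := mem_facets_iff.1 ((hmem _).1 (List.getElem_mem i.2))
  have hj := mem_facets_iff.1 ((hmem _).1 (List.getElem_mem j.2))
  have hne : l[i] ≠ l[j] := fun h => hij.ne (Fin.ext ((hnodup.getElem_inj_iff).1 h))
  obtain ⟨H, hH, hlt, R, hR, hRi, hsub, Q, hQ, -, hQR⟩ := hφ _ _ hi.2 hj.2
    (fun h => hne (Finset.map_injective _ h)) (List.pairwise_iff_getElem.1 hsort i j i.2 j.2 hij)
  obtain ⟨D, rfl⟩ := hH.1.exists_map_eq
  obtain ⟨v, hv, rfl⟩ := Finset.mem_map.1 hR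
  have hDne : D.Nonempty := Finset.map_nonempty.1
    ⟨Q, hsub (Finset.mem_erase.2 ⟨hQR.ne, hQ⟩)⟩
  obtain ⟨n, hn, rfl⟩ := List.getElem_of_mem ((hmem D).2 (mem_facets_iff.2 ⟨hDne, hH⟩))
  have hsub' : l[j].erase v ⊆ l[n] := by
    rw [← Finset.map_subset_map (f := L.vertexWord), Finset.map_erase]
    exact hsub
  -- The exchanged vertex is not in the earlier facet, as facets do not contain each other.
  have hvn : v ∉ l[n] := fun hvn => by
    have h : l[j] ⊆ l[n] := fun u hu => by
      by_cases huv : u = v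
      · exact huv ▸ hvn
      · exact hsub' (Finset.mem_erase.2 ⟨huv, hu⟩)
    have := hj.2.eq_of_subset hH.1 (Finset.map_subset_map.2 h)
    exact hlt.ne (by rw [← this])
  have hinter : l[n] ∩ l[j] = l[j].erase v := by
    ext u
    rw [Finset.mem_inter, Finset.mem_erase]
    refine ⟨fun h => ⟨fun huv => hvn (huv ▸ h.1), h.2⟩, fun h => ⟨hsub' ?_, h.2⟩⟩
    exact Finset.mem_erase.2 h
  refine ⟨⟨n, hn⟩, ?_, ?_, ?_⟩
  · by_contra! hjn
    rcases hjn.eq_or_lt with h | h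
    · subst h
      exact lt_irrefl _ hlt
    · exact absurd hlt (not_lt.2 (List.pairwise_iff_getElem.1 hsort j n j.2 hn h))
  · change l[i] ∩ l[j] ⊆ l[n] ∩ l[j]
    rw [hinter]
    intro u hu
    rw [Finset.mem_inter] at hu
    exact Finset.mem_erase.2 ⟨fun huv => hRi (huv ▸ Finset.mem_map_of_mem _ hu.1), hu.2⟩
  · change (l[n] ∩ l[j]).card + 1 = l[j].card
    rw [hinter]
    exact Finset.card_erase_add_one ((Finset.mem_map' _).1 hR)
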